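/- For groups $A$ and $B$ let $A\,\mathrm{Wr}\,B$ be their cartesian (unrestricted) standard wreath product, i.e. the set of pairs $(f,b)$ with $f\colon B\to A$ and $b\in B$, multiplied by $(f,b)(f',b')=(g,bb')$, $g(x)=f(x)f'(b^{-1}x)$, and let $A\,\mathrm{wr}\,B$ be the direct (restricted) wreath product, the subgroup of all $(f,b)$ with $f$ of finite support. Let $\mathrm{var}(G)$ be the variety of groups generated by a group $G$, i.e. the class of all groups that satisfy every identity of $G$. For varieties $\mathfrak U,\mathfrak V$ let $\mathfrak U\mathfrak V$ be the class of all groups $G$ that have a normal subgroup $N\in\mathfrak U$ with $G/N\in\mathfrak V$. Theorem. Let $A$ and $B$ be arbitrary abelian groups. The equality $\mathrm{var}(A\,\mathrm{Wr}\,B)=\mathrm{var}(A)\,\mathrm{var}(B)$ holds if and only if one of the following holds: (1) at least one of the groups $A$ and $B$ is not of finite exponent; or (2) the exponents $m=\exp A$ and $n=\exp B$ are both finite and, for every common prime divisor $p$ of $m$ and $n$, the $p$-primary component $B_p=\{b\in B : |b|=p^i\text{ for some } i\ge 0\}$ has a decomposition $B_p\cong\bigoplus_{i\in I}C_{p^{k_i}}$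 into finite cyclic groups in which infinitely many of the summands have order $p^{k'}$, where $p^{k'}$ is the highest power of $p$ dividing $n$. Likewise, $\mathrm{var}(A\,\mathrm{wr}\,B)=\mathrm{var}(A)\,\mathrm{var}(B)$ holds if and only if (1) or (2) holds. -/

import Mathlib

universe u v w

/-- The group `G` satisfies the law (identity) `x ≡ 1`, where `x` is a word in countably many
variables: every substitution of elements of `G` for the variables turns `x` into `1`. -/
def SatisfiesLaw (G : Type u) [Group G] (x : FreeGroup ℕ) : Prop :=
  ∀ f : ℕ → G, FreeGroup.lift f x = 1

/-- The variety of groups defined by a set `S` of laws, as a class of groups in universe `w`. -/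
def varietyOfLaws (S : Set (FreeGroup ℕ)) : Set GrpCat.{w} :=
  {H | ∀ x ∈ S, SatisfiesLaw H x}

/-- The variety `var G` generated by `G`: the intersection of all the varieties that contain `G`,
that is, of the varieties defined by those sets of laws which `G` satisfies. It consists
of groups in a universe `w` which need not be the universe of `G`. -/
def generatedVariety (G : Type u) [Group G] : Set GrpCat.{w} :=
  ⋂ (S : Set (FreeGroup ℕ)) (_ : ∀ x ∈ S, SatisfiesLaw G x), varietyOfLaws.{w} S

/-- The product `U V` of two classes of groups: all the extensions of a group from `U` by a group
from `V`, that is, all groups `G` with a normal subgroup `N ∈ U` such that `G ⧸ N ∈ V`. -/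
def productVariety (U V : Set GrpCat.{w}) : Set GrpCat.{w} :=
  {G | ∃ (N : Subgroup G) (_ : N.Normal), GrpCat.of N ∈ U ∧ GrpCat.of (G ⧸ N) ∈ V}

/-- The direct (restricted) standard wreath product of `A` and `B`: the subgroup of the cartesian
wreath product `A ≀ᵣ B` formed by the pairs `(f, b)` where `f : B → A` has finite support. -/
def directWreathProduct (A : Type u) (B : Type v) [Group A] [Group B] : Subgroup (A ≀ᵣ B) where
  carrier := {g | (Function.mulSupport g.left).Finite}
  one_mem' := by simp
  mul_mem' := by
    intro a b ha hb
    have hb' : (Function.mulSupport fun x ↦ b.left (a.right⁻¹ * x)).Finite :=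
      Set.Finite.preimage (f := fun x ↦ a.right⁻¹ * x) (mul_right_injective _).injOn hb
    exact (ha.union hb').subset (Function.mulSupport_mul _ _)
  inv_mem' := by
    intro a ha
    have ha' : (Function.mulSupport fun x ↦ a.left (a.right * x)).Finite :=
      Set.Finite.preimage (f := fun x ↦ a.right * x) (mul_right_injective _).injOn ha
    refine ha'.subset fun x hx ↦ ?_
    simpa using hx

/-- The `p`-primary component of `B` is a direct sum of finite cyclic `p`-groups, infinitely many
of which have order `p ^ k'`. -/
def HasInfinitelyManySummands (B : Type v) [CommGroup B] (p k' : ℕ) : Prop :=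
  ∃ (I : Type v) (k : I → ℕ),
    Nonempty (Additive (CommGroup.primaryComponent B p) ≃+ DirectSum I fun i ↦ ZMod (p ^ k i)) ∧
      {i : I | k i = k'}.Infinite

/-- The criterion: at least one of `A` and `B` is not of finite exponent; or both exponents are
finite and, for every common prime divisor `p` of them, the `p`-primary component of `B` has
infinitely many cyclic direct summands of order `p ^ k'`, where `p ^ k'` is the highest power of
`p` dividing the exponent of `B`. -/
def WreathCriterion (A : Type u) (B : Type v) [CommGroup A] [CommGroup B] : Prop :=
  (¬ Monoid.ExponentExists A ∨ ¬ Monoid.ExponentExists B) ∨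
    (Monoid.ExponentExists A ∧ Monoid.ExponentExists B ∧
      ∀ p : ℕ, p.Prime → p ∣ Monoid.exponent A → p ∣ Monoid.exponent B →
        HasInfinitelyManySummands B p ((Monoid.exponent B).factorization p))

/-! Both wreath varieties always lie in `var A · var B`: in a member of `var (A Wr B)` the values of
the laws of `B` form a normal subgroup satisfying the laws of `A`. So the question is whether the
product lies in `var (A wr B)`.

Sufficiency. By Kaloujnine–Krasner a group in the product embeds in `N Wr Q` with `N`, `Q` abelian
of exponents dividing `m` and `n` (0 when infinite). The base component of a word's value is given
by its Fox derivatives, so a law of `A wr B` has all Fox coefficients specialised to `B` divisible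
by `m` (`exponent_dvd_foxCoeff`). The criterion makes homomorphisms to `B` separate the group ring
of the free `ℤ/n`-module modulo `m` (`WreathCriterion.exponent_dvd`). Hence the universal
coefficients, and with them those at `Q`, are divisible by `m`, and the law holds in `N Wr Q`.

Necessity. If the criterion fails at `p`, Prüfer's theorem shows that the set `T` of all `b ^ (n /
p)` is finite. Commutation with `b` acts on the base group as `1 - b`. Among `|T| p` factors `1 - t`
some `t` recurs `p` times, and `p ∣ (1 - t) ^ p`; thus `[[x₀, x₁], x₂ ^ (n / p), …] ^ (m / p)` is a
law of `A Wr B`. It fails in `C_m Wr (C_n)^ℕ`, which lies in the product. -/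

/-! ### Prüfer's theorem and what the summand condition means for `B` -/

open DirectSum in
/-- A direct sum over a disjoint union of index types is a product of direct sums. -/
noncomputable def DirectSum.prodAddEquivSum {X : Type u} {Y : Type v} (γ : X ⊕ Y → Type w)
    [∀ s, AddCommMonoid (γ s)] :
    ((⨁ i, γ (Sum.inl i)) × (⨁ j, γ (Sum.inr j))) ≃+ ⨁ s, γ s := by
  classical
  exact AddMonoidHom.toAddEquiv
    ((toAddMonoid fun i ↦ of γ (Sum.inl i)).coprod (toAddMonoid fun j ↦ of γ (Sum.inr j)))
    (toAddMonoid fun s ↦ match s with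
      | Sum.inl i => (AddMonoidHom.inl _ _).comp (of (fun i ↦ γ (Sum.inl i)) i)
      | Sum.inr j => (AddMonoidHom.inr _ _).comp (of (fun j ↦ γ (Sum.inr j)) j))
    (by
      rw [AddMonoidHom.comp_coprod, ← AddMonoidHom.coprod_inl_inr]
      congr 1 <;>
      · ext i : 1
        refine AddMonoidHom.ext fun x ↦ ?_
        simp)
    (by
      ext s : 1
      refine AddMonoidHom.ext fun x ↦ ?_
      rcases s with i | j <;> simp)

theorem ZMod.pow_dvd_of_prime_mul_eq_zero {p k : ℕ} (hp : p.Prime) {c : ZMod (p ^ (k + 1))}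
    (h : (p : ZMod (p ^ (k + 1))) ^ k * c = 0) : (p : ZMod (p ^ (k + 1))) ∣ c := by
  have : NeZero (p ^ (k + 1)) := ⟨pow_ne_zero _ hp.ne_zero⟩
  obtain ⟨c, rfl⟩ := ZMod.natCast_zmod_surjective c
  rw [← Nat.cast_pow, ← Nat.cast_mul, ZMod.natCast_eq_zero_iff, pow_succ] at h
  exact Nat.cast_dvd_cast (Nat.dvd_of_mul_dvd_mul_left (pow_pos hp.pos k) h)

theorem ZMod.exists_mul_eq_prime_pow {p k : ℕ} (hp : p.Prime) {a : ZMod (p ^ (k + 1))}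
    (ha : a ≠ 0) : ∃ r, r * a = (p : ZMod (p ^ (k + 1))) ^ k := by
  have : NeZero (p ^ (k + 1)) := ⟨pow_ne_zero _ hp.ne_zero⟩
  obtain ⟨a, rfl⟩ := ZMod.natCast_zmod_surjective a
  rw [Ne, ZMod.natCast_eq_zero_iff] at ha
  obtain ⟨j, hj, hg⟩ := (Nat.dvd_prime_pow hp).1 (Nat.gcd_dvd_right a (p ^ (k + 1)))
  have hjk : j ≤ k := by
    by_contra hlt
    have : j = k + 1 := by omega
    exact ha (this ▸ hg ▸ Nat.gcd_dvd_left _ _)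
  refine ⟨((Nat.gcdA a (p ^ (k + 1)) : ℤ) : ZMod (p ^ (k + 1))) *
    (p : ZMod (p ^ (k + 1))) ^ (k - j), ?_⟩
  have hz := congrArg (Int.cast : ℤ → ZMod (p ^ (k + 1))) (Nat.gcd_eq_gcd_ab a (p ^ (k + 1)))
  rw [hg] at hz
  push_cast at hz
  have h0 : (p : ZMod (p ^ (k + 1))) ^ (k + 1) = 0 := by
    rw [← Nat.cast_pow, ZMod.natCast_self]
  rw [h0, zero_mul, add_zero] at hz
  calc _ = (p : ZMod (p ^ (k + 1))) ^ (k - j) * 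
          ((a : ZMod (p ^ (k + 1))) * ((Nat.gcdA a (p ^ (k + 1)) : ℤ) : ZMod (p ^ (k + 1)))) := by ring
    _ = _ := by rw [← hz, ← pow_add, Nat.sub_add_cancel hjk]

/-- In a module over `ℤ/p^(k+1)`, a free submodule generated by a maximal linearly independent set
is a direct summand; the complement is annihilated by `p^k`. -/
theorem exists_isCompl_span_linearIndepOn {p k : ℕ} (hp : p.Prime) (M : Type v) [AddCommGroup M]
    [Module (ZMod (p ^ (k + 1))) M] :
    ∃ (X : Set M) (C : Submodule (ZMod (p ^ (k + 1))) M),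
      LinearIndepOn (ZMod (p ^ (k + 1))) id X ∧
      IsCompl (Submodule.span (ZMod (p ^ (k + 1))) X) C ∧ ∀ c ∈ C, p ^ k • c = 0 := by
  set R := ZMod (p ^ (k + 1)) with hR
  have hpk : ((p : R)) ^ (k + 1) = 0 := by rw [← Nat.cast_pow, ZMod.natCast_self]
  have hns (j : ℕ) (x : M) : p ^ j • x = (p : R) ^ j • x := by
    rw [← Nat.cast_pow, Nat.cast_smul_eq_nsmul]
  obtain ⟨X, hX, hmax⟩ := exists_maximal_linearIndepOn R (id : M → M)
  rw [Set.image_id] at hmax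
  set D := Submodule.span R X with hD
  -- Maximality of `X` puts some nonzero multiple `a • x` in `D`, and `p ^ k` is a multiple of every
  -- nonzero `a`.
  have hpD (x : M) : (p : R) ^ k • x ∈ D := by
    by_cases hx : x ∈ X
    · exact D.smul_mem _ (Submodule.subset_span hx)
    · obtain ⟨a, ha, hax⟩ := hmax x hx
      obtain ⟨r, hr⟩ := ZMod.exists_mul_eq_prime_pow hp ha
      rw [← hr, mul_smul]
      exact D.smul_mem _ hax
  have hdiv (d : M) (hd : d ∈ D) (h0 : (p : R) ^ k • d = 0) : ∃ e ∈ D, (p : R) • e = d := by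
    have hd' : d ∈ Submodule.span R (Set.range ((↑) : X → M)) := by simpa using hd
    obtain ⟨c, rfl⟩ := (Finsupp.mem_span_range_iff_exists_finsupp).1 hd'
    have hli : LinearIndependent R ((↑) : X → M) := hX
    have hc : (p : R) ^ k • c = 0 := by
      apply hli
      simpa [Finsupp.linearCombination_apply] using h0
    have hdvd (i : X) : ∃ e : R, c i = p * e :=
      ZMod.pow_dvd_of_prime_mul_eq_zero hp (by simpa using DFunLike.congr_fun hc i)
    choose e he using hdvd
    refine ⟨c.sum fun i _ ↦ e i • (i : M), ?_, ?_⟩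
    · exact D.sum_mem fun i _ ↦ D.smul_mem _ (Submodule.subset_span i.2)
    · rw [Finsupp.smul_sum]
      exact Finsupp.sum_congr fun i _ ↦ by rw [he i, mul_smul]
  obtain ⟨C, hC⟩ : ∃ C : Submodule R M, Maximal (fun C ↦ Disjoint D C) C := by
    obtain ⟨C, -, hC⟩ := zorn_le_nonempty₀ {C : Submodule R M | Disjoint D C}
      (fun c hc hch y hy ↦ ⟨sSup c, (hch.directedOn.disjoint_sSup_right).2 fun C hC ↦ hc hC,
        fun z hz ↦ le_sSup hz⟩) ⊥ disjoint_bot_right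
    exact ⟨C, hC⟩
  have hdis := hC.prop
  have hpC (c : M) (hc : c ∈ C) : (p : R) ^ k • c = 0 :=
    (Submodule.disjoint_def.1 hdis) _ (hpD c) (C.smul_mem _ hc)
  refine ⟨X, C, hX, ⟨hdis, ?_⟩, fun c hc ↦ by rw [hns, hpC c hc]⟩
  -- Subtracting from `b` an element of `D` gives `b'` with `p • b' ∈ C`. Were `b'` outside `D ⊔ C`,
  -- maximality of `C` would give a nonzero `c₁ + j • b'` in `D`: if `p ∣ j` it also lies in `C`,
  -- otherwise `j` is a unit and `b' ∈ D ⊔ C`.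
  have hstep (b : M) (hb : (p : R) • b ∈ D ⊔ C) : b ∈ D ⊔ C := by
    obtain ⟨d, hd, c, hc, hdc⟩ := Submodule.mem_sup.1 hb
    have h0 : (p : R) ^ k • d = 0 := by
      have h1 : (p : R) ^ k • d + (p : R) ^ k • c = 0 := by
        rw [← smul_add, hdc, smul_smul, ← pow_succ, hpk, zero_smul]
      rwa [hpC c hc, add_zero] at h1
    obtain ⟨e, he, rfl⟩ := hdiv d hd h0
    by_contra hbn
    set b' := b - e with hb'
    have hpb' : (p : R) • b' ∈ C := by
      have : (p : R) • b' = c := by rw [hb', smul_sub, ← hdc]; abel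
      rwa [this]
    have hb'n : b' ∉ D ⊔ C := fun h ↦ hbn (by
      simpa [hb'] using (D ⊔ C).add_mem h (Submodule.mem_sup_left he))
    have hnd : ¬ Disjoint D (C ⊔ Submodule.span R {b'}) := fun h ↦ by
      have := hC.le_of_ge h le_sup_left
      exact hb'n (Submodule.mem_sup_right
        (this (Submodule.mem_sup_right (Submodule.mem_span_singleton_self b'))))
    rw [Submodule.disjoint_def] at hnd
    push Not at hnd
    obtain ⟨x, hxD, hx, hx0⟩ := hnd
    obtain ⟨c₁, hc₁, y, hy, rfl⟩ := Submodule.mem_sup.1 hx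
    obtain ⟨j, rfl⟩ := Submodule.mem_span_singleton.1 hy
    have : NeZero (p ^ (k + 1)) := ⟨pow_ne_zero _ hp.ne_zero⟩
    obtain ⟨j, rfl⟩ := ZMod.natCast_zmod_surjective j
    by_cases hpj : p ∣ j
    · obtain ⟨i, rfl⟩ := hpj
      apply hx0
      refine (Submodule.disjoint_def.1 hdis) _ hxD (C.add_mem hc₁ ?_)
      rw [Nat.cast_mul, mul_comm, mul_smul]
      exact C.smul_mem _ hpb'
    · have hu : IsUnit (j : R) := by
        exact (ZMod.isUnit_iff_coprime _ _).2
          (((Nat.Prime.coprime_iff_not_dvd hp).2 hpj).pow_left _).symm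
      apply hb'n
      have hjb : (j : R) • b' ∈ D ⊔ C := by
        have := (D ⊔ C).sub_mem (Submodule.mem_sup_left hxD) (Submodule.mem_sup_right hc₁)
        simpa using this
      obtain ⟨r, hr⟩ := hu.exists_left_inv
      have := (D ⊔ C).smul_mem r hjb
      rwa [smul_smul, hr, one_smul] at this
  rw [codisjoint_iff, eq_top_iff]
  have hall (j : ℕ) : ∀ b : M, (p : R) ^ j • b ∈ D ⊔ C → b ∈ D ⊔ C := by
    induction j with
    | zero => intro b hb; simpa using hb
    | succ j ih => intro b hb; exact ih b (hstep _ (by rwa [smul_smul, ← pow_succ']))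
  intro b _
  exact hall (k + 1) b (by rw [hpk, zero_smul]; exact zero_mem _)

open DirectSum in
/-- Prüfer's theorem: an abelian group of exponent dividing `p^k` is a direct sum of cyclic groups. -/
theorem exists_addEquiv_directSum_zmod_prime_pow {p : ℕ} (hp : p.Prime) (k : ℕ) :
    ∀ (M : Type v) [AddCommGroup M], (∀ x : M, p ^ k • x = 0) →
      ∃ (I : Type v) (a : I → ℕ), (∀ i, a i ≤ k) ∧ Nonempty (M ≃+ ⨁ i, ZMod (p ^ a i)) := by
  induction k with
  | zero =>
    intro M _ h
    have : Subsingleton M := ⟨fun x y ↦ by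
      have hx := h x; have hy := h y; rw [pow_zero, one_smul] at hx hy; rw [hx, hy]⟩
    refine ⟨PEmpty, fun _ ↦ 0, fun _ ↦ le_rfl, ⟨?_⟩⟩
    have : Subsingleton (⨁ i : PEmpty.{v+1}, ZMod (p ^ ((fun _ ↦ 0 : PEmpty.{v+1} → ℕ) i))) :=
      ⟨fun x y ↦ DFinsupp.ext fun i ↦ i.elim⟩
    exact ⟨⟨fun _ ↦ 0, fun _ ↦ 0, fun _ ↦ Subsingleton.elim _ _, fun _ ↦ Subsingleton.elim _ _⟩,
      fun _ _ ↦ Subsingleton.elim _ _⟩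
  | succ k ih =>
    intro M _ h
    suffices key : ∀ _ : Module (ZMod (p ^ (k + 1))) M, ∃ (I : Type v) (a : I → ℕ),
        (∀ i, a i ≤ k + 1) ∧ Nonempty (M ≃+ ⨁ i, ZMod (p ^ a i)) from
      key (AddCommGroup.zmodModule h)
    intro _
    obtain ⟨X, C, hX, hDC, hC⟩ := exists_isCompl_span_linearIndepOn (k := k) hp M
    obtain ⟨I, a, ha, ⟨e⟩⟩ := ih C (fun c : C ↦ Subtype.ext (hC c.1 c.2))
    refine ⟨X ⊕ I, Sum.elim (fun _ ↦ k + 1) a, ?_, ⟨?_⟩⟩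
    · rintro (i | i)
      · exact le_rfl
      · exact (ha i).trans k.le_succ
    · classical
      have hli : LinearIndependent (ZMod (p ^ (k + 1))) ((↑) : X → M) := hX
      have e₁ : Submodule.span (ZMod (p ^ (k + 1))) X ≃+ ⨁ _ : X, ZMod (p ^ (k + 1)) :=
        ((LinearEquiv.ofEq _ _ (by simp)).trans (hli.linearCombinationEquiv.symm.trans
          (finsuppLEquivDirectSum (ZMod (p ^ (k + 1))) (ZMod (p ^ (k + 1))) X))).toAddEquiv
      exact (Submodule.prodEquivOfIsCompl _ _ hDC).symm.toAddEquiv.trans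
        ((e₁.prodCongr e).trans
          (DirectSum.prodAddEquivSum fun s ↦ ZMod (p ^ Sum.elim (fun _ ↦ k + 1) a s)))

-- Multiplication by `p ^ k` kills every summand of order at most `p ^ k`, so only finitely many
-- finite coordinates survive.
open DirectSum in
theorem DirectSum.finite_range_nsmul {I : Type v} {p k : ℕ} (hp : p.Prime) (a : I → ℕ)
    (ha : ∀ i, a i ≤ k + 1) (hfin : {i | a i = k + 1}.Finite) :
    (Set.range fun x : ⨁ i, ZMod (p ^ a i) ↦ p ^ k • x).Finite := by
  have : ∀ i, Finite (ZMod (p ^ a i)) := fun i ↦ by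
    have : NeZero (p ^ a i) := ⟨pow_ne_zero _ hp.ne_zero⟩
    infer_instance
  have : Finite {i | a i = k + 1} := hfin
  let res : (⨁ i, ZMod (p ^ a i)) → ∀ i : {i | a i = k + 1}, ZMod (p ^ a i) := fun x i ↦ x i
  refine Set.Finite.of_finite_image (f := res) (Set.toFinite _) ?_
  rintro _ ⟨x, rfl⟩ _ ⟨y, rfl⟩ hxy
  refine DFinsupp.ext fun i ↦ ?_
  by_cases hi : a i = k + 1
  · exact congrFun hxy ⟨i, hi⟩
  · have hdvd : p ^ a i ∣ p ^ k := pow_dvd_pow _ (by have := ha i; omega)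
    have h0 (z : ZMod (p ^ a i)) : p ^ k • z = 0 := by
      rw [nsmul_eq_mul, (ZMod.natCast_eq_zero_iff _ _).2 hdvd, zero_mul]
    change p ^ k • x i = p ^ k • y i
    rw [h0, h0]

/-- With `n = p ^ (k + 1) * n'`, the power `b ^ n'` is in the `p`-component and `n / p = n' * p ^
k`, so the preceding finiteness applies there. -/
theorem finite_range_pow_of_not_hasInfinitelyManySummands {B : Type v} [CommGroup B] {p : ℕ}
    (hp : p.Prime) (hB : Monoid.ExponentExists B) (hpn : p ∣ Monoid.exponent B)
    (h : ¬ HasInfinitelyManySummands B p ((Monoid.exponent B).factorization p)) :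
    (Set.range fun b : B ↦ b ^ (Monoid.exponent B / p)).Finite := by
  set n := Monoid.exponent B with hn
  have hn0 : n ≠ 0 := Monoid.exponent_ne_zero.2 hB
  obtain ⟨k, hk⟩ : ∃ k, n.factorization p = k + 1 :=
    Nat.exists_eq_succ_of_ne_zero (hp.factorization_pos_of_dvd hn0 hpn).ne'
  set n' := n / p ^ (k + 1) with hn'
  have hnn : n = p ^ (k + 1) * n' := (Nat.mul_div_cancel' (hk ▸ Nat.ordProj_dvd n p)).symm
  have hcop : p.Coprime n' := by
    have := Nat.coprime_ordCompl hp hn0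
    rwa [hk] at this
  have hnp : n / p = n' * p ^ k := by
    rw [hnn, pow_succ]
    refine Nat.div_eq_of_eq_mul_left hp.pos (by ring)
  have hmem (b : B) : b ^ n' ∈ CommGroup.primaryComponent B p := by
    refine ⟨k + 1, ?_⟩
    rw [← pow_mul, mul_comm, ← hnn]
    exact Monoid.pow_exponent_eq_one b
  have hexp (x : Additive (CommGroup.primaryComponent B p)) : p ^ (k + 1) • x = 0 := by
    obtain ⟨⟨b, j, hj⟩, rfl⟩ := Additive.ofMul.surjective x
    rw [← ofMul_pow, ofMul_eq_zero]
    ext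
    change b ^ p ^ (k + 1) = 1
    have h1 : orderOf b ∣ p ^ j := orderOf_dvd_of_pow_eq_one hj
    have h2 : orderOf b ∣ p ^ (k + 1) * n' := hnn ▸ Monoid.order_dvd_exponent b
    exact orderOf_dvd_iff_pow_eq_one.1
      (Nat.Coprime.dvd_of_dvd_mul_right (Nat.Coprime.coprime_dvd_left h1 (hcop.pow_left j)) h2)
  obtain ⟨I, a, ha, ⟨e⟩⟩ := exists_addEquiv_directSum_zmod_prime_pow hp (k + 1) _ hexp
  have hfin : {i | a i = k + 1}.Finite := by
    by_contra hinf
    exact h ⟨I, a, ⟨e⟩, hk ▸ hinf⟩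
  refine ((DirectSum.finite_range_nsmul hp a ha hfin).image
    fun x ↦ ((e.symm x).toMul : B)).subset ?_
  rintro _ ⟨b, rfl⟩
  refine ⟨_, ⟨e (Additive.ofMul ⟨b ^ n', hmem b⟩), rfl⟩, ?_⟩
  simp only [map_nsmul, AddEquiv.symm_apply_apply]
  rw [hnp, pow_mul]
  rfl

open DirectSum in
theorem HasInfinitelyManySummands.exists_injective {B : Type v} [CommGroup B] {p k : ℕ}
    (h : HasInfinitelyManySummands B p k) (r : ℕ) :
    ∃ f : (Fin r → ZMod (p ^ k)) →+ Additive B, Function.Injective f := by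
  classical
  obtain ⟨I, a, ⟨e⟩, hinf⟩ := h
  have : Infinite {i | a i = k} := hinf.to_subtype
  let t : Fin r ↪ {i | a i = k} := (Fin.valEmbedding).trans (Infinite.natEmbedding _)
  let c (i : Fin r) : ZMod (p ^ k) ≃+ ZMod (p ^ a (t i)) :=
    (ZMod.ringEquivCongr (by rw [(t i).2])).toAddEquiv
  let g : (Fin r → ZMod (p ^ k)) →+ ⨁ i, ZMod (p ^ a i) :=
    ∑ i, ((of (fun i ↦ ZMod (p ^ a i)) (t i)).comp (c i).toAddMonoidHom).comp
      (Pi.evalAddMonoidHom _ i)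
  have hg (x : Fin r → ZMod (p ^ k)) (j : Fin r) : g x (t j) = c j (x j) := by
    simp only [g, AddMonoidHom.finsetSum_apply, DirectSum.sum_apply]
    rw [Finset.sum_eq_single j]
    · simp [DirectSum.of_eq_same]
    · intro i _ hij
      simp only [AddMonoidHom.comp_apply]
      apply DirectSum.of_eq_of_ne
      intro h
      exact hij (t.injective (Subtype.ext h)).symm
    · simp
  have hginj : Function.Injective g := fun x y hxy ↦ funext fun j ↦ (c j).injective (by
    rw [← hg, ← hg, hxy])
  let s : Additive (CommGroup.primaryComponent B p) →+ Additive B :=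
    MonoidHom.toAdditive (CommGroup.primaryComponent B p).subtype
  refine ⟨(s.comp e.symm.toAddMonoidHom).comp g, ?_⟩
  exact (Subtype.val_injective.comp e.symm.injective).comp hginj

/-! ### Laws and verbal subgroups -/

theorem mem_generatedVariety_iff {G : Type u} [Group G] {H : GrpCat.{w}} :
    H ∈ generatedVariety.{u, w} G ↔ ∀ x, SatisfiesLaw G x → SatisfiesLaw H x := by
  simp only [generatedVariety, varietyOfLaws, Set.mem_iInter, Set.mem_ofPred_eq]
  exact ⟨fun h x hx ↦ h {x} (by simpa using hx) x rfl, fun h S hS x hx ↦ h x (hS x hx)⟩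

section Laws

open scoped commutatorElement

variable {G : Type u} {H : Type v} [Group G] [Group H]

theorem FreeGroup.map_lift {α : Type w} (φ : G →* H) (f : α → G) (x : FreeGroup α) :
    φ (FreeGroup.lift f x) = FreeGroup.lift (φ ∘ f) x := by
  rw [← MonoidHom.comp_apply]
  exact DFunLike.congr_fun (FreeGroup.ext_hom _ _ fun a ↦ by simp) x

theorem FreeGroup.lift_lift {α β : Type*} (f : β → G) (g : α → FreeGroup β) (x : FreeGroup α) :
    FreeGroup.lift f (FreeGroup.lift g x) = FreeGroup.lift (fun i ↦ FreeGroup.lift f (g i)) x :=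
  FreeGroup.map_lift _ _ _

theorem SatisfiesLaw.of_injective {x : FreeGroup ℕ} (h : SatisfiesLaw H x) (φ : G →* H)
    (hφ : Function.Injective φ) : SatisfiesLaw G x := fun f ↦
  hφ (by rw [FreeGroup.map_lift, h, map_one])

theorem SatisfiesLaw.of_surjective {x : FreeGroup ℕ} (h : SatisfiesLaw G x) (φ : G →* H)
    (hφ : Function.Surjective φ) : SatisfiesLaw H x := fun f ↦ by
  choose g hg using fun i ↦ hφ (f i)
  obtain rfl : φ ∘ g = f := funext hg
  rw [← FreeGroup.map_lift, h, map_one]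

theorem SatisfiesLaw.pi {x : FreeGroup ℕ} (h : SatisfiesLaw G x) (ι : Type w) :
    SatisfiesLaw (ι → G) x := fun f ↦ funext fun i ↦
  (FreeGroup.map_lift (Pi.evalMonoidHom (fun _ : ι ↦ G) i) f x).trans (h _)

/-- The set of laws of a group is closed under substitution of words for the variables. -/
theorem SatisfiesLaw.lift {x : FreeGroup ℕ} (h : SatisfiesLaw G x) (f : ℕ → FreeGroup ℕ) :
    SatisfiesLaw G (FreeGroup.lift f x) := fun g ↦ by
  rw [FreeGroup.lift_lift]
  exact h _

theorem satisfiesLaw_commutator_iff :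
    SatisfiesLaw G ⁅FreeGroup.of 0, FreeGroup.of 1⁆ ↔ ∀ a b : G, a * b = b * a := by
  constructor
  · intro h a b
    have := h fun i ↦ if i = 0 then a else b
    rw [map_commutatorElement] at this
    simpa [commutatorElement_eq_one_iff_mul_comm] using this
  · intro h f
    rw [map_commutatorElement, commutatorElement_eq_one_iff_mul_comm]
    exact h _ _

theorem satisfiesLaw_pow_iff (n : ℕ) :
    SatisfiesLaw G (FreeGroup.of 0 ^ n) ↔ ∀ a : G, a ^ n = 1 := by
  constructor
  · intro h a
    simpa using h fun _ ↦ a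
  · intro h f
    simp [h]

end Laws

section Verbal

variable (B : Type v) [Group B] (H : Type w) [Group H]

/-- The verbal subgroup of `H` formed by the values of the laws of `B`. -/
def verbalSubgroup : Subgroup H where
  carrier := {h | ∃ x, SatisfiesLaw B x ∧ ∃ f : ℕ → H, FreeGroup.lift f x = h}
  one_mem' := ⟨1, fun _ ↦ map_one _, fun _ ↦ 1, map_one _⟩
  mul_mem' := by
    rintro _ _ ⟨x, hx, f, rfl⟩ ⟨y, hy, g, rfl⟩
    -- Even and odd variables keep the two words disjoint, so one substitution serves both.
    refine ⟨FreeGroup.lift (fun i ↦ FreeGroup.of (2 * i)) x *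
      FreeGroup.lift (fun i ↦ FreeGroup.of (2 * i + 1)) y, fun k ↦ ?_,
      fun i ↦ if i % 2 = 0 then f (i / 2) else g (i / 2), ?_⟩
    · rw [map_mul, hx.lift, hy.lift, one_mul]
    · rw [map_mul, FreeGroup.lift_lift, FreeGroup.lift_lift]
      congr 3 <;> funext i
      · simp
      · simp [Nat.add_mod, show (2 * i + 1) / 2 = i by omega]
  inv_mem' := by
    rintro _ ⟨x, hx, f, rfl⟩
    exact ⟨x⁻¹, fun k ↦ by rw [map_inv, hx, inv_one], f, map_inv _ _⟩

instance : (verbalSubgroup B H).Normal where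
  conj_mem := by
    rintro _ ⟨x, hx, f, rfl⟩ g
    exact ⟨x, hx, _, (FreeGroup.map_lift (MulAut.conj g).toMonoidHom f x).symm⟩

variable {B H}

theorem satisfiesLaw_quotient_verbalSubgroup {x : FreeGroup ℕ} (hx : SatisfiesLaw B x) :
    SatisfiesLaw (H ⧸ verbalSubgroup B H) x := fun f ↦ by
  choose g hg using fun i ↦ QuotientGroup.mk'_surjective (verbalSubgroup B H) (f i)
  obtain rfl : QuotientGroup.mk' (verbalSubgroup B H) ∘ g = f := funext hg
  rw [← FreeGroup.map_lift]
  exact (QuotientGroup.eq_one_iff _).2 ⟨x, hx, g, rfl⟩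

end Verbal

/-! ### Wreath products and the inclusions that always hold -/

namespace RegularWreathProduct

variable {A : Type u} {B : Type v} [Group A] [Group B]

/-- The embedding of the base group into the wreath product. -/
def baseHom (A : Type u) (B : Type v) [Group A] [Group B] : (B → A) →* A ≀ᵣ B where
  toFun f := ⟨f, 1⟩
  map_one' := rfl
  map_mul' f g := by ext <;> simp

theorem exists_baseHom_eq {g : A ≀ᵣ B} (hg : g.right = 1) : ∃ f, baseHom A B f = g :=
  ⟨g.left, by ext <;> simp [baseHom, hg]⟩

theorem right_lift (f : ℕ → A ≀ᵣ B) (x : FreeGroup ℕ) :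
    (FreeGroup.lift f x).right = FreeGroup.lift (fun i ↦ (f i).right) x :=
  FreeGroup.map_lift (rightHom : A ≀ᵣ B →* B) f x

/-- The values of laws of `B` lie in the base group, a power of `A`. -/
theorem satisfiesLaw_lift {x : FreeGroup ℕ} (hx : SatisfiesLaw A x) {b : ℕ → FreeGroup ℕ}
    (hb : ∀ i, SatisfiesLaw B (b i)) : SatisfiesLaw (A ≀ᵣ B) (FreeGroup.lift b x) := fun f ↦ by
  rw [FreeGroup.lift_lift]
  choose g hg using fun i ↦ exists_baseHom_eq
    (show (FreeGroup.lift f (b i)).right = 1 by rw [right_lift, hb])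
  simp_rw [← hg]
  rw [show (fun i ↦ baseHom A B (g i)) = baseHom A B ∘ g from rfl, ← FreeGroup.map_lift,
    hx.pi, map_one]

/-- The Kaloujnine–Krasner embedding of an extension into a wreath product. -/
noncomputable def kaloujnineKrasner {G : Type u} [Group G] (N : Subgroup G) [N.Normal] :
    G →* N ≀ᵣ (G ⧸ N) where
  toFun g := ⟨fun x ↦ ⟨(Quotient.out x)⁻¹ * g * Quotient.out ((g : G ⧸ N)⁻¹ * x), by
    rw [← QuotientGroup.eq_one_iff, QuotientGroup.mk_mul, QuotientGroup.mk_mul,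
      QuotientGroup.mk_inv, QuotientGroup.out_eq', QuotientGroup.out_eq']
    group⟩, g⟩
  map_one' := by ext <;> simp
  map_mul' g h := by ext <;> simp [mul_assoc]

theorem kaloujnineKrasner_injective {G : Type u} [Group G] (N : Subgroup G) [N.Normal] :
    Function.Injective (kaloujnineKrasner N) := by
  refine (injective_iff_map_eq_one _).2 fun g hg ↦ ?_
  have hr : (g : G ⧸ N) = 1 := congrArg RegularWreathProduct.right hg
  have hl := congrArg Subtype.val (congrFun (congrArg RegularWreathProduct.left hg) 1)
  change (Quotient.out (1 : G ⧸ N))⁻¹ * g * Quotient.out ((g : G ⧸ N)⁻¹ * 1) = 1 at hl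
  rw [hr, inv_one, one_mul] at hl
  have := congrArg (fun z ↦ Quotient.out (1 : G ⧸ N) * z * (Quotient.out (1 : G ⧸ N))⁻¹) hl
  simpa [mul_assoc] using this

end RegularWreathProduct

section Varieties

open RegularWreathProduct

variable {A : Type u} {B : Type v} [Group A] [Group B]

theorem generatedVariety_wreath_subset : generatedVariety.{max u v, w} (A ≀ᵣ B) ⊆
    productVariety (generatedVariety.{u, w} A) (generatedVariety.{v, w} B) := by
  intro H hH
  rw [mem_generatedVariety_iff] at hH
  refine ⟨verbalSubgroup B H, inferInstance, ?_, ?_⟩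
  · rw [mem_generatedVariety_iff]
    intro x hx f
    choose b hb g hg using fun i ↦ (f i).2
    have hlaw := satisfiesLaw_lift hx (b := fun i ↦ FreeGroup.lift
      (fun j ↦ FreeGroup.of (Nat.pair i j)) (b i)) (fun i ↦ (hb i).lift _)
    have := hH _ hlaw fun k ↦ g k.unpair.1 k.unpair.2
    rw [FreeGroup.lift_lift] at this
    simp only [FreeGroup.lift_lift, FreeGroup.lift_apply_of, Nat.unpair_pair, hg] at this
    exact Subtype.ext ((FreeGroup.map_lift (verbalSubgroup B H).subtype f x).trans this)
  · rw [mem_generatedVariety_iff]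
    exact fun x hx ↦ satisfiesLaw_quotient_verbalSubgroup hx

theorem generatedVariety_directWreathProduct_subset :
    generatedVariety.{max u v, w} (directWreathProduct A B) ⊆
      generatedVariety.{max u v, w} (A ≀ᵣ B) := by
  intro H hH
  rw [mem_generatedVariety_iff] at hH ⊢
  exact fun x hx ↦ hH x (hx.of_injective (directWreathProduct A B).subtype Subtype.val_injective)

/-- A wreath product of members of two varieties belongs to the product of the varieties. -/
theorem wreath_mem_productVariety {N Q : Type w} [Group N] [Group Q]
    (hN : GrpCat.of N ∈ generatedVariety.{u, w} A) (hQ : GrpCat.of Q ∈ generatedVariety.{v, w} B) :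
    GrpCat.of (N ≀ᵣ Q) ∈
      productVariety (generatedVariety.{u, w} A) (generatedVariety.{v, w} B) := by
  rw [mem_generatedVariety_iff] at hN hQ
  refine ⟨(rightHom : N ≀ᵣ Q →* Q).ker, inferInstance, ?_, ?_⟩
  · rw [mem_generatedVariety_iff]
    intro x hx
    refine SatisfiesLaw.of_surjective (G := Q → N) ((hN x hx).pi Q)
      ((baseHom N Q).codRestrict _ fun f ↦ by rw [MonoidHom.mem_ker]; rfl) ?_
    rintro ⟨g, hg⟩
    obtain ⟨f, rfl⟩ := exists_baseHom_eq (show g.right = 1 from hg)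
    exact ⟨f, rfl⟩
  · rw [mem_generatedVariety_iff]
    intro x hx
    exact (hQ x hx).of_injective (QuotientGroup.kerLift (rightHom : N ≀ᵣ Q →* Q))
      (QuotientGroup.kerLift_injective _)

end Varieties

/-! ### Fox calculus: laws of wreath products with abelian base -/

section Fox

/-- The action of the free group on the free module with basis `ℕ × FreeGroup ℕ` by left
translation of the second coordinate. -/
noncomputable def foxTranslation :
    FreeGroup ℕ →* MulAut (Multiplicative (ℕ × FreeGroup ℕ →₀ ℤ)) where
  toFun g := AddEquiv.toMultiplicative
    (Finsupp.domCongr ((Equiv.refl ℕ).prodCongr (Equiv.mulLeft g)))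
  map_one' := by
    refine MulEquiv.ext fun d ↦ Multiplicative.toAdd.injective (Finsupp.ext fun i ↦ ?_)
    change d.toAdd (i.1, 1⁻¹ * i.2) = d.toAdd i
    rw [inv_one, one_mul]
  map_mul' g h := by
    refine MulEquiv.ext fun d ↦ Multiplicative.toAdd.injective (Finsupp.ext fun i ↦ ?_)
    change d.toAdd (i.1, (g * h)⁻¹ * i.2) = d.toAdd (i.1, h⁻¹ * (g⁻¹ * i.2))
    rw [mul_inv_rev, mul_assoc]

/-- The Magnus representation of the free group. -/
noncomputable def foxHom : FreeGroup ℕ →*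
    Multiplicative (ℕ × FreeGroup ℕ →₀ ℤ) ⋊[foxTranslation] FreeGroup ℕ :=
  FreeGroup.lift fun i ↦ ⟨Multiplicative.ofAdd (Finsupp.single (i, 1) 1), FreeGroup.of i⟩

/-- The Fox derivatives of a word: the value at `(i, g)` is the coefficient of `g` in the
derivative with respect to the variable `i`. -/
noncomputable def foxDerivative (x : FreeGroup ℕ) : ℕ × FreeGroup ℕ →₀ ℤ :=
  (foxHom x).left.toAdd

/-- The Fox derivatives of a word with the variables specialised to elements of `Q`. -/
noncomputable def foxCoeff {Q : Type v} [Group Q] (q : ℕ → Q) (x : FreeGroup ℕ) : ℕ × Q →₀ ℤ :=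
  (foxDerivative x).mapDomain (Prod.map id (FreeGroup.lift q))

variable {N : Type u} {Q : Type v} [CommGroup N] [Group Q]

/-- The value at `y` of the element of the base group obtained by applying a tuple of elements of
the group ring of `Q` to the left components of the elements `σ i`. -/
noncomputable def foxEval (σ : ℕ → N ≀ᵣ Q) (y : Q) : (ℕ × Q →₀ ℤ) →+ Additive N :=
  Finsupp.liftAddHom fun i ↦ zmultiplesHom _ (Additive.ofMul ((σ i.1).left (i.2⁻¹ * y)))

theorem foxEval_mapDomain_translation (σ : ℕ → N ≀ᵣ Q) (y : Q) (g : FreeGroup ℕ)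
    (d : Multiplicative (ℕ × FreeGroup ℕ →₀ ℤ)) :
    foxEval σ y ((foxTranslation g d).toAdd.mapDomain
        (Prod.map id (FreeGroup.lift fun i ↦ (σ i).right))) =
      foxEval σ ((FreeGroup.lift (fun i ↦ (σ i).right) g)⁻¹ * y)
        (d.toAdd.mapDomain (Prod.map id (FreeGroup.lift fun i ↦ (σ i).right))) := by
  induction d using Multiplicative.rec with | ofAdd d =>
  change foxEval σ y ((Finsupp.domCongr ((Equiv.refl ℕ).prodCongr (Equiv.mulLeft g)) d).mapDomain
    _) = foxEval σ _ (d.mapDomain _)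
  induction d using Finsupp.induction_linear with
  | zero => simp
  | add f₁ f₂ h₁ h₂ => simp only [map_add, Finsupp.mapDomain_add, h₁, h₂]
  | single i c =>
    simp [foxEval, Finsupp.domCongr_apply, Finsupp.mapDomain_single, mul_assoc]

/-- Evaluation at `σ` is a homomorphism `Θ` from the Magnus group, and `Θ ∘ foxHom` agrees with
`FreeGroup.lift σ` on the generators. -/
theorem left_lift_eq_foxEval (σ : ℕ → N ≀ᵣ Q) (x : FreeGroup ℕ) (y : Q) :
    (FreeGroup.lift σ x).left y = (foxEval σ y (foxCoeff (fun i ↦ (σ i).right) x)).toMul := by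
  let Θ : Multiplicative (ℕ × FreeGroup ℕ →₀ ℤ) ⋊[foxTranslation] FreeGroup ℕ →* N ≀ᵣ Q :=
    { toFun := fun s ↦ ⟨fun y ↦ (foxEval σ y (s.left.toAdd.mapDomain
        (Prod.map id (FreeGroup.lift fun i ↦ (σ i).right)))).toMul,
        FreeGroup.lift (fun i ↦ (σ i).right) s.right⟩
      map_one' := by ext <;> simp
      map_mul' := fun s t ↦ by
        ext y
        · simp [Finsupp.mapDomain_add, foxEval_mapDomain_translation]
        · simp }
  have h : Θ (foxHom x) = FreeGroup.lift σ x := by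
    rw [foxHom, FreeGroup.map_lift]
    congr 2
    funext i
    ext y <;> simp [Θ, foxEval]
  rw [← h]
  rfl

theorem satisfiesLaw_wreath_of_dvd_foxCoeff {x : FreeGroup ℕ} {m : ℕ} (hm : ∀ z : N, z ^ m = 1)
    (hx : SatisfiesLaw Q x) (h : ∀ (q : ℕ → Q) (i : ℕ × Q), (m : ℤ) ∣ foxCoeff q x i) :
    SatisfiesLaw (N ≀ᵣ Q) x := fun σ ↦ by
  ext y
  · rw [left_lift_eq_foxEval]
    simp only [foxEval, Finsupp.liftAddHom_apply]
    rw [Finsupp.sum, Finset.sum_eq_zero]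
    · rfl
    · intro i _
      obtain ⟨c, hc⟩ := h (fun i ↦ (σ i).right) i
      rw [hc, zmultiplesHom_apply, mul_comm, mul_smul, natCast_zsmul, ← ofMul_pow, hm, ofMul_one,
        smul_zero]
  · rw [RegularWreathProduct.right_lift, hx]
    rfl

theorem exponent_dvd_foxCoeff {x : FreeGroup ℕ} (h : SatisfiesLaw (directWreathProduct N Q) x)
    (q : ℕ → Q) (i : ℕ × Q) : (Monoid.exponent N : ℤ) ∣ foxCoeff q x i := by
  classical
  rw [← dvd_abs, Int.abs_eq_natAbs, Int.natCast_dvd_natCast,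
    Monoid.exponent_dvd_iff_forall_pow_eq_one]
  intro a
  -- Only the variable `i.1` gets a base part, `a` at the identity; the value at `i.2` is then `a`
  -- to the single coefficient at `i`.
  let σ (j : ℕ) : directWreathProduct N Q :=
    ⟨⟨if j = i.1 then Pi.mulSingle 1 a else 1, q j⟩, by
      change (Function.mulSupport (if j = i.1 then Pi.mulSingle 1 a else 1)).Finite
      split_ifs
      · exact (Set.finite_singleton 1).subset Pi.mulSupport_mulSingle_subset
      · simp⟩
  have h1 : (FreeGroup.lift (fun j ↦ (σ j : N ≀ᵣ Q)) x).left i.2 = 1 := by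
    rw [show (fun j ↦ (σ j : N ≀ᵣ Q)) = (directWreathProduct N Q).subtype ∘ σ from rfl,
      ← FreeGroup.map_lift, h]
    rfl
  rw [left_lift_eq_foxEval] at h1
  simp only [foxEval, Finsupp.liftAddHom_apply] at h1
  rw [Finsupp.sum_eq_single i] at h1
  · have h2 : a ^ (foxCoeff q x i) = 1 := by simpa [σ] using h1
    rwa [pow_natAbs_eq_one]
  · intro j _ hj
    by_cases hji : j.1 = i.1
    · have : j.2⁻¹ * i.2 ≠ 1 := fun h ↦ hj (Prod.ext hji (inv_mul_eq_one.1 h))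
      simp [σ, hji, Pi.mulSingle_eq_of_ne this]
    · simp [σ, hji]
  · simp

end Fox

/-! ### Separating the group ring by homomorphisms to `B` -/

/-- `F` is the indicator of 0 multiplied by all `1 - shift (s q)`. The orders of the `s q` are
distinct primes, so no other term returns to 0; the support bound carries this through the
induction. -/
theorem exists_fun_eq_sub_shift {C : Type u} [AddCommGroup C] (s : ℕ → C) (S : Finset ℕ)
    (hS : ∀ q ∈ S, q.Prime ∧ s q ≠ 0 ∧ q • s q = 0) :
    ∃ F : C → ℤ, F 0 = 1 ∧ (∀ x, F x ≠ 0 → (∏ q ∈ S, q) • x = 0) ∧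
      ∀ q ∈ S, ∃ G : C → ℤ, ∀ x, F x = G x - G (x - s q) := by
  classical
  induction S using Finset.induction_on with
  | empty => exact ⟨Pi.single 0 1, by simp, fun x hx ↦ by
      by_contra h
      simp only [Finset.prod_empty, one_smul] at h
      exact hx (Pi.single_eq_of_ne h _), by simp⟩
  | insert q S hq ih =>
    obtain ⟨F, hF0, hF, hG⟩ := ih fun q hq ↦ hS q (Finset.mem_insert_of_mem hq)
    obtain ⟨hqp, hsq, hqs⟩ := hS q (Finset.mem_insert_self q S)
    refine ⟨fun x ↦ F x - F (x - s q), ?_, fun x hx ↦ ?_, fun q' hq' ↦ ?_⟩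
    · have : F (0 - s q) = 0 := by
        by_contra h
        have h1 := hF _ h
        rw [zero_sub, smul_neg, neg_eq_zero] at h1
        have hc : Nat.Coprime q (∏ q ∈ S, q) := Nat.Coprime.prod_right fun q' hq' ↦
          (Nat.coprime_primes hqp (hS q' (Finset.mem_insert_of_mem hq')).1).2
            fun h ↦ hq (h ▸ hq')
        have h2 := Nat.dvd_gcd (addOrderOf_dvd_of_nsmul_eq_zero hqs)
          (addOrderOf_dvd_of_nsmul_eq_zero h1)
        rw [hc, Nat.dvd_one, AddMonoid.addOrderOf_eq_one_iff] at h2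
        exact hsq h2
      change F 0 - F (0 - s q) = 1
      rw [this, hF0, sub_zero]
    · rw [Finset.prod_insert hq, mul_comm, mul_smul]
      by_cases h : F x = 0
      · have h1 := hF (x - s q) (by intro h'; simp [h, h'] at hx)
        rw [smul_sub, sub_eq_zero] at h1
        rw [smul_comm, h1, smul_comm, hqs, smul_zero]
      · rw [smul_comm, hF x h, smul_zero]
    · rcases Finset.mem_insert.1 hq' with rfl | hq'
      · exact ⟨F, fun x ↦ rfl⟩
      · obtain ⟨G, hG⟩ := hG q' hq'
        refine ⟨fun x ↦ G x - G (x - s q), fun x ↦ ?_⟩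
        change F x - F (x - s q) = G x - G (x - s q) - (G (x - s q') - G (x - s q' - s q))
        rw [hG, hG, sub_right_comm x (s q)]
        ring

theorem ZMod.exists_mul_eq_div_prime {n : ℕ} [NeZero n] {a : ZMod n} (ha : a ≠ 0) :
    ∃ q ∈ n.primeFactors, ∃ c : ZMod n, c * a = (n / q : ℕ) := by
  obtain ⟨a, rfl⟩ := ZMod.natCast_zmod_surjective a
  rw [Ne, ZMod.natCast_eq_zero_iff] at ha
  obtain ⟨t, ht⟩ := Nat.gcd_dvd_right a n
  have hn : n ≠ 0 := NeZero.ne n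
  have ht1 : t ≠ 1 := by
    rintro rfl
    rw [mul_one] at ht
    exact ha (ht ▸ Nat.gcd_dvd_left _ _)
  obtain ⟨q, hq, s, rfl⟩ := Nat.exists_prime_and_dvd ht1
  refine ⟨q, Nat.mem_primeFactors.2 ⟨hq, ⟨Nat.gcd a n * s, ht.trans (by ring)⟩, hn⟩,
    s * (Nat.gcdA a n : ℤ), ?_⟩
  have hdiv : n / q = Nat.gcd a n * s :=
    Nat.div_eq_of_eq_mul_left hq.pos (ht.trans (by ring))
  have hz := congrArg (Int.cast : ℤ → ZMod n) (Nat.gcd_eq_gcd_ab a n)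
  push_cast at hz
  rw [ZMod.natCast_self, zero_mul, add_zero] at hz
  rw [hdiv, Nat.cast_mul, hz]
  ring

/-- A combination of indicator functions of points of `ZMod n`, pulled back along all linear
functionals, which is a multiple of the indicator function of the origin. -/
theorem ZMod.exists_sum_dotProduct_eq (n r : ℕ) [NeZero n] : ∃ F : ZMod n → ℤ,
    ∀ h : Fin r → ZMod n,
      ∑ ψ : Fin r → ZMod n, F (∑ i, ψ i * h i) = if h = 0 then (n : ℤ) ^ r else 0 := by
  classical
  have hn : n ≠ 0 := NeZero.ne n
  obtain ⟨F, hF0, -, hG⟩ := exists_fun_eq_sub_shift (C := ZMod n) (fun q ↦ ((n / q : ℕ) : ZMod n))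
    n.primeFactors fun q hq ↦ by
      obtain ⟨hqp, hqn, -⟩ := Nat.mem_primeFactors.1 hq
      refine ⟨hqp, ?_, ?_⟩
      · rw [Ne, ZMod.natCast_eq_zero_iff]
        intro h
        have := Nat.le_of_dvd (Nat.div_pos (Nat.le_of_dvd (Nat.pos_of_ne_zero hn) hqn) hqp.pos) h
        exact absurd (Nat.div_lt_self (Nat.pos_of_ne_zero hn) hqp.one_lt) (by omega)
      · rw [nsmul_eq_mul, ← Nat.cast_mul, Nat.mul_div_cancel' hqn, ZMod.natCast_self]
  refine ⟨F, fun h ↦ ?_⟩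
  split_ifs with h0
  · simp [h0, hF0, ZMod.card]
  · obtain ⟨i, hi⟩ := Function.ne_iff.1 h0
    obtain ⟨q, hq, c, hc⟩ := ZMod.exists_mul_eq_div_prime hi
    obtain ⟨G, hG⟩ := hG q hq
    simp_rw [hG, Finset.sum_sub_distrib]
    rw [sub_eq_zero, eq_comm]
    -- As `c * h i = n / q`, translating `ψ` by `Pi.single i c` shifts the argument by exactly the
    -- step of `G`, and the sums cancel.
    refine Fintype.sum_equiv (Equiv.subRight (Pi.single i c)) _ _ fun ψ ↦ ?_
    simp only [Equiv.subRight_apply, Pi.sub_apply, sub_mul, Finset.sum_sub_distrib]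
    rw [Finset.sum_eq_single (f := fun j ↦ (Pi.single i c : Fin r → ZMod n) j * h j) i
      (fun j _ hj ↦ by rw [Pi.single_eq_of_ne hj, zero_mul]) (by simp), Pi.single_eq_same, hc]

/-- The kernel in `hK` isolates the coefficient at `h₀`; interchanging sums writes `N * v h₀`
through coefficients of pushforwards. -/
theorem dvd_mul_of_forall_dvd_mapDomain {V : Type u} {C : Type v} [AddCommGroup V]
    [DecidableEq V] [AddCommGroup C] {J : Type w} [Fintype J] (φ : J → V →+ C) (F : J → C → ℤ)
    (v : V →₀ ℤ) {m N : ℤ} (hφ : ∀ j z, m ∣ v.mapDomain (φ j) z) (h₀ : V)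
    (hK : ∀ h ∈ v.support, ∑ j, F j (φ j (h - h₀)) = if h = h₀ then N else 0) :
    m ∣ N * v h₀ := by
  classical
  have key : N * v h₀ = ∑ j, (v.mapDomain (φ j)).sum fun z c ↦ c * F j (z - φ j h₀) := by
    calc N * v h₀ = v.sum fun h c ↦ c * ∑ j, F j (φ j (h - h₀)) := by
          rw [Finsupp.sum, Finset.sum_congr rfl fun h hh ↦ by rw [hK h hh]]
          simp only [mul_ite, mul_zero, Finset.sum_ite_eq', Finsupp.mem_support_iff]
          split_ifs with h
          · ring
          · rw [not_not.1 h, mul_zero]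
      _ = ∑ j, v.sum fun h c ↦ c * F j (φ j h - φ j h₀) := by
          simp only [Finsupp.sum, Finset.mul_sum, map_sub]
          rw [Finset.sum_comm]
      _ = _ := by
          refine Finset.sum_congr rfl fun j _ ↦ ?_
          rw [Finsupp.sum_mapDomain_index (by simp) (by intros; ring)]
  rw [key]
  exact Finset.dvd_sum fun j _ ↦ Finset.dvd_sum fun z _ ↦ (hφ j z).mul_right _

theorem exists_coprime_dvd_mul {B : Type v} [AddCommGroup B] {n p k n' : ℕ} (hp : p.Prime)
    (hn : n = p ^ k * n') (hn' : n' ≠ 0) (hcop : p.Coprime n')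
    (hB : ∀ r, ∃ f : (Fin r → ZMod (p ^ k)) →+ B, Function.Injective f)
    {b : B} (hb : addOrderOf b = n') (v : (ℕ →₀ ZMod n) →₀ ℤ) {m : ℤ}
    (hv : ∀ (φ : (ℕ →₀ ZMod n) →+ B) (z : B), m ∣ v.mapDomain φ z) (h₀ : ℕ →₀ ZMod n) :
    ∃ N : ℕ, p.Coprime N ∧ m ∣ N * v h₀ := by
  classical
  have : NeZero n' := ⟨hn'⟩
  have : NeZero n := ⟨hn ▸ mul_ne_zero (pow_ne_zero _ hp.ne_zero) hn'⟩
  obtain ⟨r, hr⟩ : ∃ r : ℕ, ∀ h ∈ insert h₀ v.support, ∀ i, r ≤ i → h i = 0 := by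
    refine ⟨((insert h₀ v.support).biUnion Finsupp.support).sup id + 1, fun h hh i hi ↦ ?_⟩
    by_contra hne
    have := Finset.le_sup (f := id)
      (Finset.mem_biUnion.2 ⟨h, hh, Finsupp.mem_support_iff.2 hne⟩)
    simp only [id] at this
    omega
  obtain ⟨f, hf⟩ := hB r
  let g : ZMod n' →+ B := ZMod.lift n' ⟨zmultiplesHom B b, by
    rw [zmultiplesHom_apply, natCast_zsmul, ← hb, addOrderOf_nsmul_eq_zero]⟩
  have hg (a : ℕ) : g a = a • b := by
    have := ZMod.lift_coe n' ⟨zmultiplesHom B b, by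
      rw [zmultiplesHom_apply, natCast_zsmul, ← hb, addOrderOf_nsmul_eq_zero]⟩ (a : ℤ)
    simpa using this
  let θ : (Fin r → ZMod (p ^ k)) × ZMod n' →+ B := f.coprod g
  have hθ : Function.Injective θ := by
    refine (injective_iff_map_eq_zero θ).2 fun z hz ↦ ?_
    obtain ⟨x, y⟩ := z
    obtain ⟨y, rfl⟩ := ZMod.natCast_zmod_surjective y
    have hz : f x + y • b = 0 := by rw [← hg]; exact hz
    have hpx : p ^ k • x = 0 := funext fun i ↦ by simp
    have h1 := congrArg (p ^ k • ·) hz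
    simp only [smul_add, ← map_nsmul, hpx, map_zero, zero_add, smul_zero, smul_smul] at h1
    have h2 : n' ∣ y :=
      Nat.Coprime.dvd_of_dvd_mul_left (hcop.pow_left k).symm
        (hb ▸ addOrderOf_dvd_of_nsmul_eq_zero h1)
    have hy : y • b = 0 := addOrderOf_dvd_iff_nsmul_eq_zero.1 (hb ▸ h2)
    rw [hy, add_zero, ← map_zero f] at hz
    rw [hf hz, (ZMod.natCast_eq_zero_iff _ _).2 h2]
    rfl
  let c₁ : ZMod n →+* ZMod (p ^ k) := ZMod.castHom ⟨n', hn⟩ _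
  let c₂ : ZMod n →+* ZMod n' := ZMod.castHom ⟨p ^ k, hn.trans (mul_comm _ _)⟩ _
  have hc (a : ZMod n) (h1 : c₁ a = 0) (h2 : c₂ a = 0) : a = 0 := by
    obtain ⟨a, rfl⟩ := ZMod.natCast_zmod_surjective a
    rw [map_natCast, ZMod.natCast_eq_zero_iff] at h1 h2
    rw [ZMod.natCast_eq_zero_iff]
    rw [hn]
    exact (hcop.pow_left k).mul_dvd_of_dvd_of_dvd h1 h2
  -- The `p`-part is kept whole. Only one cyclic group of order `n'` is available for the rest, so
  -- it is read through functionals `ψ`, at the cost of the factor `n' ^ r`, prime to `p`.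
  let φ (ψ : Fin r → ZMod n') : (ℕ →₀ ZMod n) →+ (Fin r → ZMod (p ^ k)) × ZMod n' :=
    { toFun := fun h ↦ (fun i ↦ c₁ (h i), ∑ i : Fin r, ψ i * c₂ (h i))
      map_zero' := by ext <;> simp
      map_add' := fun x y ↦ by ext <;> simp [mul_add, Finset.sum_add_distrib] }
  obtain ⟨F, hF⟩ := ZMod.exists_sum_dotProduct_eq n' r
  refine ⟨n' ^ r, hcop.pow_right r, ?_⟩
  rw [Nat.cast_pow]
  refine dvd_mul_of_forall_dvd_mapDomain φ (fun _ z ↦ if z.1 = 0 then F z.2 else 0) v ?_ h₀ ?_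
  · intro ψ z
    have := hv (θ.comp (φ ψ)) (θ z)
    rwa [AddMonoidHom.coe_comp, Finsupp.mapDomain_comp, Finsupp.mapDomain_apply hθ] at this
  · intro h hh
    by_cases h1 : (fun i : Fin r ↦ c₁ ((h - h₀) i)) = 0
    · calc _ = ∑ ψ : Fin r → ZMod n', F (∑ i : Fin r, ψ i * c₂ ((h - h₀) i)) :=
            Finset.sum_congr rfl fun ψ _ ↦ if_pos h1
        _ = _ := hF fun i ↦ c₂ ((h - h₀) i)
        _ = _ := by
          refine if_congr ⟨fun h2 ↦ ?_, ?_⟩ rfl rfl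
          · rw [← sub_eq_zero]
            ext i
            rcases lt_or_ge i r with hi | hi
            · exact hc _ (congrFun h1 ⟨i, hi⟩) (congrFun h2 ⟨i, hi⟩)
            · simp [hr h (Finset.mem_insert_of_mem hh) i hi, hr h₀ (Finset.mem_insert_self _ _) i hi]
          · rintro rfl
            ext i
            simp
    · rw [if_neg (by rintro rfl; exact h1 (by ext; simp))]
      exact Finset.sum_eq_zero fun ψ _ ↦ if_neg h1

/-- Read as polynomials, the elements of `S` have a nonzero product; `t` is evaluation at a
non-root. -/
theorem exists_addMonoidHom_int_ne_zero (S : Finset (ℕ →₀ ℤ)) (hS : ∀ h ∈ S, h ≠ 0) :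
    ∃ t : (ℕ →₀ ℤ) →+ ℤ, ∀ h ∈ S, t h ≠ 0 := by
  let P (h : ℕ →₀ ℤ) : Polynomial ℤ := ⟨⟨h⟩⟩
  have hP : ∏ h ∈ S, P h ≠ 0 := Finset.prod_ne_zero_iff.2 fun h hh h0 ↦ hS h hh (by
    have := congrArg (fun q : Polynomial ℤ ↦ q.toFinsupp.coeff) h0
    exact this)
  obtain ⟨M, hM⟩ : ∃ M : ℤ, (∏ h ∈ S, P h).eval M ≠ 0 := by
    by_contra! h
    exact hP (Polynomial.funext fun M ↦ by rw [h M, Polynomial.eval_zero])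
  rw [Polynomial.eval_prod, Finset.prod_ne_zero_iff] at hM
  exact ⟨(Polynomial.evalRingHom M).toAddMonoidHom.comp
    { toFun := P, map_zero' := rfl, map_add' := fun _ _ ↦ rfl }, hM⟩

theorem exists_addMonoidHom_injOn {B : Type v} [AddCommGroup B]
    (hB : ∀ j : ℕ, j ≠ 0 → ∃ b : B, j • b ≠ 0) (S : Finset (ℕ →₀ ℤ)) :
    ∃ φ : (ℕ →₀ ℤ) →+ B, Set.InjOn φ S := by
  classical
  obtain ⟨t, ht⟩ := exists_addMonoidHom_int_ne_zero
    ((S ×ˢ S).image (fun z ↦ z.1 - z.2) |>.erase 0) fun h hh ↦ (Finset.mem_erase.1 hh).1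
  let J := ∏ h ∈ ((S ×ˢ S).image (fun z ↦ z.1 - z.2) |>.erase 0), (t h).natAbs
  obtain ⟨b, hb⟩ := hB J (Finset.prod_ne_zero_iff.2 fun h hh ↦ Int.natAbs_ne_zero.2 (ht h hh))
  refine ⟨(zmultiplesHom B b).comp t, fun x hx y hy hxy ↦ ?_⟩
  by_contra hne
  apply hb
  have hmem : x - y ∈ ((S ×ˢ S).image (fun z ↦ z.1 - z.2)).erase 0 :=
    Finset.mem_erase.2 ⟨sub_ne_zero.2 hne, Finset.mem_image.2 ⟨(x, y), by simpa using ⟨hx, hy⟩, rfl⟩⟩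
  obtain ⟨c, hc⟩ := Finset.dvd_prod_of_mem (fun h ↦ (t h).natAbs) hmem
  have h0 : (t (x - y)) • b = 0 := by
    rw [map_sub, sub_smul, sub_eq_zero]
    exact hxy
  change (∏ h ∈ _, (t h).natAbs) • b = 0
  rw [hc, mul_comm, mul_smul, natAbs_nsmul_eq_zero.2 h0, smul_zero]

/-- The group ring of a free abelian group of exponent `exp B` over `ℤ / exp A` is separated by
homomorphisms to `B`, when the criterion holds. -/
theorem WreathCriterion.exponent_dvd {A : Type u} {B : Type v} [CommGroup A] [CommGroup B]
    (h : WreathCriterion A B) (v : (ℕ →₀ ZMod (Monoid.exponent B)) →₀ ℤ)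
    (hv : ∀ (φ : (ℕ →₀ ZMod (Monoid.exponent B)) →+ Additive B) (z : Additive B),
      (Monoid.exponent A : ℤ) ∣ v.mapDomain φ z)
    (h₀ : ℕ →₀ ZMod (Monoid.exponent B)) : (Monoid.exponent A : ℤ) ∣ v h₀ := by
  by_cases hB : Monoid.ExponentExists B
  · have hn0 : Monoid.exponent B ≠ 0 := Monoid.exponent_ne_zero.2 hB
    obtain ⟨b, hb⟩ := Monoid.exists_orderOf_eq_exponent hB
    have key (p : ℕ) (hp : p.Prime) (hpB : p ∣ Monoid.exponent B →
        HasInfinitelyManySummands B p ((Monoid.exponent B).factorization p)) :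
        ∃ N : ℕ, p.Coprime N ∧ (Monoid.exponent A : ℤ) ∣ N * v h₀ := by
      have hnn := (Nat.ordProj_mul_ordCompl_eq_self (Monoid.exponent B) p).symm
      refine exists_coprime_dvd_mul (b := Additive.ofMul
        (b ^ p ^ (Monoid.exponent B).factorization p)) hp hnn (Nat.ordCompl_pos p hn0).ne'
        (Nat.coprime_ordCompl hp hn0) (fun r ↦ ?_) ?_ v hv h₀
      · by_cases hpn : p ∣ Monoid.exponent B
        · exact (hpB hpn).exists_injective r
        · have : Subsingleton (ZMod (p ^ (Monoid.exponent B).factorization p)) := by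
            rw [Nat.factorization_eq_zero_of_not_dvd hpn, pow_zero]
            infer_instance
          exact ⟨0, Function.injective_of_subsingleton _⟩
      · rw [addOrderOf_ofMul_eq_orderOf, orderOf_pow_of_dvd (pow_ne_zero _ hp.ne_zero)
          (hb ▸ Nat.ordProj_dvd _ _), hb]
    by_cases hA : Monoid.ExponentExists A
    · have hcrit : ∀ p : ℕ, p.Prime → p ∣ Monoid.exponent A → p ∣ Monoid.exponent B →
          HasInfinitelyManySummands B p ((Monoid.exponent B).factorization p) := by
        rcases h with (h | h) | h
        · exact absurd hA h
        · exact absurd hB h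
        · exact h.2.2
      rw [Int.natCast_dvd, Nat.dvd_iff_prime_pow_dvd_dvd]
      intro p j hp hj
      rcases Nat.eq_zero_or_pos j with rfl | hjpos
      · simp
      obtain ⟨N, hN, hdvd⟩ := key p hp (hcrit p hp ((dvd_pow_self p hjpos.ne').trans hj))
      rw [Int.natCast_dvd, Int.natAbs_mul, Int.natAbs_natCast] at hdvd
      exact Nat.Coprime.dvd_of_dvd_mul_left (hN.pow_left j) (hj.trans hdvd)
    -- Here `exponent A = 0` and divisibility means vanishing; any prime not dividing `exponent B`
    -- makes `key` unconditional.
    · obtain ⟨p, hpn, hp⟩ := Nat.exists_infinite_primes (Monoid.exponent B + 1)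
      have hpB : ¬ p ∣ Monoid.exponent B := fun hd ↦ by
        have := Nat.le_of_dvd (Nat.pos_of_ne_zero hn0) hd
        omega
      obtain ⟨N, hN, hdvd⟩ := key p hp fun hd ↦ absurd hd hpB
      rw [Monoid.exponent_eq_zero_iff.2 hA, Nat.cast_zero, zero_dvd_iff] at hdvd ⊢
      rcases mul_eq_zero.1 hdvd with h0 | h0
      · rw [Nat.cast_eq_zero] at h0
        rw [h0, Nat.coprime_zero_right] at hN
        exact absurd hN hp.ne_one
      · exact h0
  · have hB' (j : ℕ) (hj : j ≠ 0) : ∃ b : Additive B, j • b ≠ 0 := by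
      by_contra! hall
      exact hB ⟨j, Nat.pos_of_ne_zero hj, hall⟩
    have hn0 := Monoid.exponent_eq_zero_iff.2 hB
    revert v h₀
    rw [hn0]
    intro v hv h₀
    classical
    -- `ZMod 0` is `ℤ`; a map injective on the finite support reads off `v h₀` directly.
    obtain ⟨φ, hφ⟩ : ∃ φ : (ℕ →₀ ZMod 0) →+ Additive B,
        Set.InjOn φ (insert h₀ v.support : Finset (ℕ →₀ ZMod 0)) :=
      exists_addMonoidHom_injOn hB' (insert h₀ v.support)
    have := hv φ (φ h₀)
    rwa [Finsupp.mapDomain_apply' _ _ (Finset.coe_subset.2 (Finset.subset_insert _ _)) hφ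
      (Finset.mem_coe.2 (Finset.mem_insert_self _ _))] at this

/-! ### Sufficiency of the criterion -/

theorem Finsupp.mapDomain_prodMap_id_apply {α β γ : Type*} (f : β → γ) (c : α × β →₀ ℤ)
    (i : α) (z : γ) : c.mapDomain (Prod.map id f) (i, z) = (c.curry i).mapDomain f z := by
  classical
  induction c using Finsupp.induction_linear with
  | zero =>
    rw [show (0 : α × β →₀ ℤ).curry = 0 from map_zero Finsupp.curryAddEquiv]
    simp
  | add c₁ c₂ h₁ h₂ =>
    rw [Finsupp.mapDomain_add, Finsupp.add_apply, h₁, h₂,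
      show (c₁ + c₂).curry = c₁.curry + c₂.curry from map_add Finsupp.curryAddEquiv c₁ c₂,
      Finsupp.add_apply, Finsupp.mapDomain_add, Finsupp.add_apply]
  | single j a =>
    rw [Finsupp.mapDomain_single, ← Prod.mk.eta (p := j), Finsupp.curry_single]
    by_cases hj : j.1 = i
    · subst hj
      simp [Finsupp.single_apply, Prod.ext_iff]
    · simp [Prod.ext_iff, hj]

/-- The Fox derivatives of a word, specialised to the free `ℤ/n`-module on the variables. -/
noncomputable def abelianFoxCoeff (n : ℕ) (x : FreeGroup ℕ) : ℕ × (ℕ →₀ ZMod n) →₀ ℤ :=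
  (foxDerivative x).mapDomain (Prod.map id fun g ↦
    (FreeGroup.lift (fun j ↦ Multiplicative.ofAdd (Finsupp.single j (1 : ZMod n))) g).toAdd)

theorem foxCoeff_apply_eq_mapDomain {n : ℕ} {H : Type v} [CommGroup H]
    (φ : (ℕ →₀ ZMod n) →+ Additive H) (x : FreeGroup ℕ) (i : ℕ) (z : H) :
    foxCoeff (fun j ↦ (φ (Finsupp.single j 1)).toMul) x (i, z) =
      ((abelianFoxCoeff n x).curry i).mapDomain φ (Additive.ofMul z) := by
  have h (g : FreeGroup ℕ) : FreeGroup.lift (fun j ↦ (φ (Finsupp.single j 1)).toMul) g =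
      (φ (FreeGroup.lift (fun j ↦ Multiplicative.ofAdd (Finsupp.single j (1 : ZMod n))) g).toAdd
        ).toMul :=
    (FreeGroup.map_lift (AddMonoidHom.toMultiplicativeLeft φ) _ g).symm
  rw [← Finsupp.mapDomain_apply Additive.toMul.injective, ← Finsupp.mapDomain_comp, toMul_ofMul,
    ← Finsupp.mapDomain_prodMap_id_apply, abelianFoxCoeff, ← Finsupp.mapDomain_comp, foxCoeff]
  congr 2
  funext g
  exact Prod.ext rfl (h g.2)

theorem WreathCriterion.satisfiesLaw_wreath {A : Type u} {B : Type v} [CommGroup A] [CommGroup B]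
    (h : WreathCriterion A B) {N Q : Type w} [CommGroup N] [CommGroup Q]
    (hN : ∀ z : N, z ^ Monoid.exponent A = 1) (hQ : ∀ z : Q, z ^ Monoid.exponent B = 1)
    {x : FreeGroup ℕ} (hx : SatisfiesLaw (directWreathProduct A B) x) (hxQ : SatisfiesLaw Q x) :
    SatisfiesLaw (N ≀ᵣ Q) x := by
  refine satisfiesLaw_wreath_of_dvd_foxCoeff hN hxQ ?_
  rintro q ⟨i, y⟩
  set n := Monoid.exponent B
  have hv := h.exponent_dvd ((abelianFoxCoeff n x).curry i) fun φ z ↦ by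
    rw [← ofMul_toMul z, ← foxCoeff_apply_eq_mapDomain]
    exact exponent_dvd_foxCoeff hx _ _
  -- Since `n` kills `Q`, `q` extends to the free `ℤ/n`-module, and coefficients at `Q` are sums of
  -- universal ones.
  obtain ⟨ρ, hρ⟩ : ∃ ρ : (ℕ →₀ ZMod n) →+ Additive Q,
      ∀ j, (ρ (Finsupp.single j 1)).toMul = q j := by
    let : Module (ZMod n) (Additive Q) := AddCommGroup.zmodModule (n := n) hQ
    exact ⟨(Finsupp.linearCombination (ZMod n) fun j ↦ Additive.ofMul (q j)).toAddMonoidHom,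
      fun j ↦ by simp⟩
  obtain rfl : (fun j ↦ (ρ (Finsupp.single j 1)).toMul) = q := funext hρ
  rw [foxCoeff_apply_eq_mapDomain]
  classical
  rw [Finsupp.mapDomain, Finsupp.sum_apply]
  refine Finset.dvd_sum fun g _ ↦ ?_
  simp only [Finsupp.single_apply]
  split_ifs
  · exact hv g
  · exact dvd_zero _

theorem WreathCriterion.productVariety_subset {A : Type u} {B : Type v} [CommGroup A]
    [CommGroup B] (h : WreathCriterion A B) :
    productVariety (generatedVariety.{u, w} A) (generatedVariety.{v, w} B) ⊆
      generatedVariety.{max u v, w} (directWreathProduct A B) := by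
  rintro G ⟨N, hnorm, hN, hQ⟩
  rw [mem_generatedVariety_iff] at hN hQ ⊢
  intro x hx
  refine SatisfiesLaw.of_injective ?_ _ (RegularWreathProduct.kaloujnineKrasner_injective N)
  have hxB : SatisfiesLaw B x := by
    refine hx.of_injective (G := B) (RegularWreathProduct.inl.codRestrict _ fun b ↦ ?_) ?_
    · change (Function.mulSupport (1 : B → A)).Finite
      simp
    · intro b c hbc
      exact congrArg (fun z : directWreathProduct A B ↦ z.1.right) hbc
  let : CommGroup N := { (inferInstance : Group N) with
    mul_comm := satisfiesLaw_commutator_iff.1 (hN _ (satisfiesLaw_commutator_iff.2 mul_comm)) }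
  let : CommGroup (G ⧸ N) := { (inferInstance : Group (G ⧸ N)) with
    mul_comm := satisfiesLaw_commutator_iff.1 (hQ _ (satisfiesLaw_commutator_iff.2 mul_comm)) }
  exact h.satisfiesLaw_wreath
    ((satisfiesLaw_pow_iff _).1 (hN _ ((satisfiesLaw_pow_iff _).2 Monoid.pow_exponent_eq_one)))
    ((satisfiesLaw_pow_iff _).1 (hQ _ ((satisfiesLaw_pow_iff _).2 Monoid.pow_exponent_eq_one)))
    hx (hQ x hxB)

/-! ### Necessity: a law separating the two varieties -/

open scoped commutatorElement

section LeftCommutator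

/-- The left-normed commutator `[[[z, y 0], y 1], …, y (k - 1)]`. -/
def leftCommutator {G : Type u} [Group G] (z : G) (y : ℕ → G) : ℕ → G
  | 0 => z
  | k + 1 => ⁅leftCommutator z y k, y k⁆

theorem map_leftCommutator {G : Type u} {H : Type v} [Group G] [Group H] (φ : G →* H) (z : G)
    (y : ℕ → G) (k : ℕ) :
    φ (leftCommutator z y k) = leftCommutator (φ z) (fun i ↦ φ (y i)) k := by
  induction k with
  | zero => rfl
  | succ k ih => rw [leftCommutator, leftCommutator, map_commutatorElement, ih]

end LeftCommutator

namespace RegularWreathProduct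

theorem commutator_baseHom {A : Type u} {B : Type v} [CommGroup A] [Group B] (f : B → A)
    (g : A ≀ᵣ B) :
    ⁅baseHom A B f, g⁆ = baseHom A B fun x ↦ f x * (f (g.right⁻¹ * x))⁻¹ := by
  rw [commutatorElement_def]
  ext x
  · simp [baseHom, mul_assoc, mul_left_comm]
  · simp [baseHom]

variable {A : Type u} {B : Type v} [CommGroup A] [CommGroup B]

/-- The action of `B` by translations on the base group of the wreath product. -/
def baseTranslation (A : Type u) (B : Type v) [CommGroup A] [CommGroup B] :
    B →* Module.End ℤ (Additive (B → A)) where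
  toFun b := AddMonoidHom.toIntLinearMap
    { toFun := fun f ↦ Additive.ofMul fun x ↦ f.toMul (b⁻¹ * x)
      map_zero' := rfl
      map_add' := fun _ _ ↦ rfl }
  map_one' := by
    refine LinearMap.ext fun f ↦ Additive.toMul.injective (funext fun x ↦ ?_)
    change f.toMul (1⁻¹ * x) = f.toMul x
    rw [inv_one, one_mul]
  map_mul' b c := by
    refine LinearMap.ext fun f ↦ Additive.toMul.injective (funext fun x ↦ ?_)
    change f.toMul ((b * c)⁻¹ * x) = f.toMul (c⁻¹ * (b⁻¹ * x))
    rw [mul_inv_rev, mul_assoc]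

/-- The action of the integral group ring of `B` on the base group of the wreath product. -/
noncomputable def baseAction (A : Type u) (B : Type v) [CommGroup A] [CommGroup B] :
    MonoidAlgebra ℤ B →ₐ[ℤ] Module.End ℤ (Additive (B → A)) :=
  MonoidAlgebra.lift ℤ (Module.End ℤ (Additive (B → A))) B (baseTranslation A B)

/-- Turns iterated commutators into products in a commutative group ring, where repeated factors can
be collected. -/
theorem leftCommutator_baseHom (f : B → A) (g : ℕ → A ≀ᵣ B) (k : ℕ) :
    leftCommutator (baseHom A B f) g k = baseHom A B
      (baseAction A B (∏ i ∈ Finset.range k, (1 - MonoidAlgebra.of ℤ B (g i).right))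
        (Additive.ofMul f)).toMul := by
  induction k with
  | zero => simp [leftCommutator]
  | succ k ih =>
    rw [leftCommutator, ih, commutator_baseHom, Finset.prod_range_succ, mul_comm, map_mul]
    congr 1
    funext x
    rw [Module.End.mul_apply, map_sub, map_one, LinearMap.sub_apply, Module.End.one_apply,
      baseAction, MonoidAlgebra.lift_of, toMul_sub, div_eq_mul_inv]
    rfl

end RegularWreathProduct

/-- Modulo `p` the power is `1 + (-t) ^ p`, which is 0 for odd `p` and 2 for `p = 2`. -/
theorem Nat.Prime.dvd_one_sub_pow {R : Type u} [CommRing R] {p : ℕ} (hp : p.Prime) {t : R}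
    (ht : t ^ p = 1) : (p : R) ∣ (1 - t) ^ p := by
  obtain ⟨r, hr⟩ := exists_add_pow_prime_eq hp (1 : R) (-t)
  rw [← sub_eq_add_neg, one_pow] at hr
  rw [hr, mul_assoc, mul_assoc]
  refine dvd_add ?_ (dvd_mul_right _ _)
  rcases hp.eq_two_or_odd' with rfl | hodd
  · rw [neg_sq, ht, one_add_one_eq_two, Nat.cast_two]
  · rw [hodd.neg_pow, ht, add_neg_cancel]
    exact dvd_zero _

theorem Nat.Prime.dvd_prod_one_sub_of_finite {B : Type v} [CommGroup B] {p : ℕ} (hp : p.Prime)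
    (T : Finset B) (hT : ∀ t ∈ T, t ^ p = 1) (τ : ℕ → B) (hτ : ∀ i, τ i ∈ T) :
    (p : MonoidAlgebra ℤ B) ∣
      ∏ i ∈ Finset.range (T.card * p), (1 - MonoidAlgebra.of ℤ B (τ i)) := by
  classical
  obtain ⟨t, ht, hcard⟩ := Finset.exists_le_card_fiber_of_mul_le_card_of_maps_to
    (s := Finset.range (T.card * p)) (t := T) (f := τ) (n := p) (fun i _ ↦ hτ i) ⟨τ 0, hτ 0⟩
    (by rw [Finset.card_range])
  have h1 : (p : MonoidAlgebra ℤ B) ∣ (1 - MonoidAlgebra.of ℤ B t) ^ p :=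
    hp.dvd_one_sub_pow (by rw [← map_pow, hT t ht, map_one])
  refine (h1.trans (pow_dvd_pow _ hcard)).trans ?_
  rw [← Finset.prod_const, Finset.prod_congr rfl fun i hi ↦ by
    rw [← (Finset.mem_filter.1 hi).2]]
  exact Finset.prod_dvd_prod_of_subset _ _ _ (Finset.filter_subset _ _)

/-- The word `[[x₀, x₁], x₂ ^ e, x₃ ^ e, …] ^ d` with `l` entries of the form `xᵢ ^ e`. -/
def commutatorPowerWord (e d l : ℕ) : FreeGroup ℕ :=
  leftCommutator ⁅FreeGroup.of 0, FreeGroup.of 1⁆ (fun i ↦ FreeGroup.of (i + 2) ^ e) l ^ d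

open RegularWreathProduct in
theorem satisfiesLaw_commutatorPowerWord {A : Type u} {B : Type v} [CommGroup A] [CommGroup B]
    {p m e : ℕ} (hp : p.Prime) (hpm : p ∣ m) (hA : ∀ a : A, a ^ m = 1) (T : Finset B)
    (hT : ∀ t ∈ T, t ^ p = 1) (hBT : ∀ b : B, b ^ e ∈ T) :
    SatisfiesLaw (A ≀ᵣ B) (commutatorPowerWord e (m / p) (T.card * p)) := by
  intro σ
  rw [commutatorPowerWord, map_pow, map_leftCommutator, map_commutatorElement]
  obtain ⟨f, hf⟩ := exists_baseHom_eq
    (show ⁅FreeGroup.lift σ (FreeGroup.of 0), FreeGroup.lift σ (FreeGroup.of 1)⁆.right = 1 by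
      rw [← rightHom_eq_right, map_commutatorElement, commutatorElement_eq_one_iff_mul_comm,
        mul_comm])
  rw [← hf, leftCommutator_baseHom]
  obtain ⟨r, hr⟩ := hp.dvd_prod_one_sub_of_finite T hT
    (fun i ↦ (FreeGroup.lift σ (FreeGroup.of (i + 2) ^ e)).right) (fun i ↦ by
      rw [map_pow, ← rightHom_eq_right, map_pow]
      exact hBT _)
  rw [hr, ← map_pow, ← toMul_nsmul, map_mul, map_natCast, Module.End.mul_apply,
    Module.End.natCast_apply, smul_smul, Nat.div_mul_cancel hpm, toMul_nsmul]
  convert map_one (baseHom A B) using 2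
  exact funext fun x ↦ hA _

-- Each commutator uses a fresh coordinate, so the translated copy of the support misses the
-- identity and the value there is unchanged.
open RegularWreathProduct in
theorem exists_leftCommutator_mulSingle_eq_baseHom {N : Type u} {C : Type v} [CommGroup N]
    [CommGroup C] {d : C} (hd : d ≠ 1) (f : (ℕ → C) → N)
    (hf : ∀ x j, x (j + 1) ≠ 1 → f x = 1) (k : ℕ) :
    ∃ F : (ℕ → C) → N, leftCommutator (baseHom N (ℕ → C) f)
        (fun i ↦ inl (Pi.mulSingle (i + 1) d)) k = baseHom N (ℕ → C) F ∧ F 1 = f 1 ∧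
      ∀ x j, k ≤ j → x (j + 1) ≠ 1 → F x = 1 := by
  induction k with
  | zero => exact ⟨f, rfl, rfl, fun x j _ ↦ hf x j⟩
  | succ k ih =>
    obtain ⟨F, hF, hF1, hFs⟩ := ih
    refine ⟨_, by rw [leftCommutator, hF, commutator_baseHom], ?_, fun x j hj hx ↦ ?_⟩
    · rw [hF1, hFs ((inl (Pi.mulSingle (k + 1) d) : N ≀ᵣ (ℕ → C)).right⁻¹ * 1) k le_rfl
        (by simpa using hd), inv_one, mul_one]
    · rw [hFs x j (by omega) hx, hFs _ j (by omega), inv_one, mul_one]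
      rw [right_inl, Pi.mul_apply, Pi.inv_apply, Pi.mulSingle_eq_of_ne (by omega), inv_one, one_mul]
      exact hx

open RegularWreathProduct in
theorem not_satisfiesLaw_commutatorPowerWord {N : Type u} {C : Type v} [CommGroup N]
    [CommGroup C] {e d : ℕ} {a : N} {c : C} (ha : a ^ d ≠ 1) (hc : c ^ e ≠ 1) (l : ℕ) :
    ¬ SatisfiesLaw (N ≀ᵣ (ℕ → C)) (commutatorPowerWord e d l) := by
  classical
  intro h
  have hc1 : c ≠ 1 := by rintro rfl; exact hc (one_pow e)
  -- Every variable after the first moves its own coordinate, so the word's base component at the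
  -- identity is `a ^ d`.
  let σ : ℕ → N ≀ᵣ (ℕ → C)
    | 0 => baseHom N (ℕ → C) (Pi.mulSingle 1 a)
    | i + 1 => inl (Pi.mulSingle i c)
  have hσ1 : (σ 1).right = Pi.mulSingle 0 c := rfl
  have h := h σ
  rw [commutatorPowerWord, map_pow, map_leftCommutator, map_commutatorElement] at h
  simp only [map_pow, FreeGroup.lift_apply_of] at h
  have hσ (i : ℕ) : σ (i + 2) ^ e = inl (Pi.mulSingle (i + 1) (c ^ e)) := by
    rw [Pi.mulSingle_pow, map_pow]
  simp only [hσ] at h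
  rw [show σ 0 = baseHom N (ℕ → C) (Pi.mulSingle 1 a) from rfl, commutator_baseHom] at h
  obtain ⟨F, hF, hF1, -⟩ := exists_leftCommutator_mulSingle_eq_baseHom (N := N) hc
    (fun x ↦ (Pi.mulSingle 1 a : (ℕ → C) → N) x *
      ((Pi.mulSingle 1 a : (ℕ → C) → N) ((σ 1).right⁻¹ * x))⁻¹) (fun x j hx ↦ by
      have h1 : x ≠ 1 := fun h ↦ hx (congrFun h _)
      have h2 : (σ 1).right⁻¹ * x ≠ 1 := fun h ↦ hx (by
        rw [inv_mul_eq_one] at h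
        rw [← h, hσ1, Pi.mulSingle_eq_of_ne (by omega)])
      rw [Pi.mulSingle_eq_of_ne (M := fun _ ↦ N) h1, Pi.mulSingle_eq_of_ne (M := fun _ ↦ N) h2,
        inv_one, mul_one]) l
  rw [hF, ← map_pow] at h
  have h3 : F 1 ^ d = 1 := congrFun (congrArg RegularWreathProduct.left h) 1
  have h4 : (σ 1).right⁻¹ * 1 ≠ 1 := fun h ↦ hc1 (by
    rw [mul_one, inv_eq_one, hσ1] at h
    exact (Pi.mulSingle_eq_same (M := fun _ ↦ C) 0 c).symm.trans (congrFun h 0))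
  rw [hF1, Pi.mulSingle_eq_same, Pi.mulSingle_eq_of_ne h4, inv_one, mul_one] at h3
  exact ha h3

/-- An element of order `exponent A` exists in `A`; `ULift` moves the cyclic group to the universe
of the variety. -/
theorem cyclic_mem_generatedVariety {A : Type u} [CommGroup A] (hA : Monoid.ExponentExists A) :
    GrpCat.of (ULift.{w} (Multiplicative (ZMod (Monoid.exponent A)))) ∈
      generatedVariety.{u, w} A := by
  rw [mem_generatedVariety_iff]
  intro x hx
  obtain ⟨a, ha⟩ := Monoid.exists_orderOf_eq_exponent hA
  let f : ZMod (Monoid.exponent A) →+ Additive A :=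
    ZMod.lift _ ⟨zmultiplesHom _ (Additive.ofMul a), by
      rw [zmultiplesHom_apply, natCast_zsmul, ← ofMul_pow, Monoid.pow_exponent_eq_one, ofMul_one]⟩
  have hf : Function.Injective f := by
    refine (ZMod.lift_injective _).2 fun j hj ↦ ?_
    have hj : a ^ j = 1 := hj
    rwa [ZMod.intCast_zmod_eq_zero_iff_dvd, ← ha, orderOf_dvd_iff_zpow_eq_one]
  refine hx.of_injective ((AddMonoidHom.toMultiplicativeLeft f).comp MulEquiv.ulift.toMonoidHom) ?_
  exact hf.comp (ULift.down_injective)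

theorem exists_pow_ne_one_ulift_zmod {n p : ℕ} (hn : n ≠ 0) (hp : p.Prime) (hpn : p ∣ n) :
    ∃ c : ULift.{w} (Multiplicative (ZMod n)), c ^ (n / p) ≠ 1 := by
  refine ⟨⟨Multiplicative.ofAdd 1⟩, fun h ↦ ?_⟩
  have h1 : Multiplicative.ofAdd (1 : ZMod n) ^ (n / p) = 1 := congrArg ULift.down h
  rw [← ofAdd_nsmul, ofAdd_eq_one, nsmul_one, ZMod.natCast_eq_zero_iff] at h1
  have h2 := Nat.le_of_dvd (Nat.div_pos (Nat.le_of_dvd (Nat.pos_of_ne_zero hn) hpn) hp.pos) h1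
  exact absurd (Nat.div_lt_self (Nat.pos_of_ne_zero hn) hp.one_lt) (by omega)

/-- If the criterion fails, some law of the wreath product fails in the product variety. -/
theorem exists_law_of_not_wreathCriterion {A : Type u} {B : Type v} [CommGroup A] [CommGroup B]
    (h : ¬ WreathCriterion A B) : ∃ x, SatisfiesLaw (A ≀ᵣ B) x ∧
      ∃ G ∈ productVariety (generatedVariety.{u, w} A) (generatedVariety.{v, w} B),
        ¬ SatisfiesLaw G x := by
  rw [WreathCriterion, not_or, not_or, not_not, not_not] at h
  obtain ⟨⟨hA, hB⟩, h⟩ := h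
  push Not at h
  obtain ⟨p, hp, hpA, hpB, h⟩ := h hA hB
  have hfin := finite_range_pow_of_not_hasInfinitelyManySummands hp hB hpB h
  obtain ⟨a, ha⟩ := exists_pow_ne_one_ulift_zmod.{w} (Monoid.exponent_ne_zero.2 hA) hp hpA
  obtain ⟨c, hc⟩ := exists_pow_ne_one_ulift_zmod.{w} (Monoid.exponent_ne_zero.2 hB) hp hpB
  refine ⟨_, satisfiesLaw_commutatorPowerWord (e := Monoid.exponent B / p) hp hpA
    Monoid.pow_exponent_eq_one hfin.toFinset ?_ fun b ↦ hfin.mem_toFinset.2 ⟨b, rfl⟩, _,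
    wreath_mem_productVariety (cyclic_mem_generatedVariety hA)
      (Q := ℕ → ULift.{w} (Multiplicative (ZMod (Monoid.exponent B)))) ?_,
    not_satisfiesLaw_commutatorPowerWord ha hc _⟩
  · intro t ht
    obtain ⟨b, rfl⟩ := hfin.mem_toFinset.1 ht
    change (b ^ (Monoid.exponent B / p)) ^ p = 1
    rw [← pow_mul, Nat.div_mul_cancel hpB, Monoid.pow_exponent_eq_one]
  · have hC := mem_generatedVariety_iff.1 (cyclic_mem_generatedVariety.{v, w} hB)
    exact mem_generatedVariety_iff.2 fun x hx ↦ (hC x hx).pi ℕ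

theorem theorem2p1 (A : Type u) (B : Type v) [CommGroup A] [CommGroup B] :
    (generatedVariety.{max u v, w} (A ≀ᵣ B) =
        productVariety (generatedVariety.{u, w} A) (generatedVariety.{v, w} B) ↔
      WreathCriterion A B) ∧
    (generatedVariety.{max u v, w} (directWreathProduct A B) =
        productVariety (generatedVariety.{u, w} A) (generatedVariety.{v, w} B) ↔
      WreathCriterion A B) := by
  refine ⟨⟨fun h ↦ ?_, fun h ↦ ?_⟩, ⟨fun h ↦ ?_, fun h ↦ ?_⟩⟩
  · by_contra hcrit
    obtain ⟨x, hx, G, hG, hGx⟩ := exists_law_of_not_wreathCriterion.{u, v, w} hcrit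
    rw [← h, mem_generatedVariety_iff] at hG
    exact hGx (hG x hx)
  · exact generatedVariety_wreath_subset.antisymm
      (h.productVariety_subset.trans generatedVariety_directWreathProduct_subset)
  · by_contra hcrit
    obtain ⟨x, hx, G, hG, hGx⟩ := exists_law_of_not_wreathCriterion.{u, v, w} hcrit
    rw [← h] at hG
    exact hGx (mem_generatedVariety_iff.1 (generatedVariety_directWreathProduct_subset hG) x hx)
  · exact (generatedVariety_directWreathProduct_subset.trans
      generatedVariety_wreath_subset).antisymm h.productVariety_subset
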